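/- Let $G$ be a finite simple graph with at least two vertices that is not Hamiltonian (that is, $G$ has no cycle through all of its vertices). Let $k\ge 0$ be an integer and suppose that $G$ is $k$-connected, meaning that for any two distinct vertices $u$ and $v$ of $G$ there exists a set of $k$ distinct $u$-$v$ paths that pairwise share no vertex other than $u$ and $v$. Paths are simple, the length of a path is its number of edges, and a longest path is a path of maximum length among all paths of $G$. Let $L$ be the length of a longest path in $G$, and let $P$ and $Q$ be two longest paths in $G$. Then $$|V(P)\cap V(Q)| \;\ge\; 2k-\frac{L}{2}.$$ -/

import Mathlib

namespace SimpleGraph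

/-- `G` is `k`-connected: any two distinct vertices `u`, `v` are joined by a set of `k` distinct
`u`-`v` paths that pairwise share no vertex other than `u` and `v`. -/
def IsKConnected {V : Type*} (G : SimpleGraph V) (k : ℕ) : Prop :=
  ∀ u v : V, u ≠ v → ∃ S : Finset (G.Path u v), S.card = k ∧
    ∀ P ∈ S, ∀ Q ∈ S, P ≠ Q →
      ∀ x : V, x ∈ (P : G.Walk u v).support → x ∈ (Q : G.Walk u v).support → x = u ∨ x = v

/-- `L` is the length (number of edges) of a longest path in `G`. -/
def IsLongestPathLength {V : Type*} (G : SimpleGraph V) (L : ℕ) : Prop :=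
  IsGreatest {m : ℕ | ∃ (u v : V) (R : G.Walk u v), R.IsPath ∧ R.length = m} L

/-- `P` is a longest path in `G`: a path of maximum length among all paths of `G`,
whatever their ends. -/
def Walk.IsLongestPath {V : Type*} {G : SimpleGraph V} {a b : V} (P : G.Walk a b) : Prop :=
  P.IsPath ∧ ∀ (u v : V) (R : G.Walk u v), R.IsPath → R.length ≤ P.length

end SimpleGraph

namespace SimpleGraph

/-! ### Surgery on paths, and what maximality forbids. -/

namespace Walk

variable {V : Type*} {G : SimpleGraph V} {u v w : V}

/-! Let `t` be the number of shared vertices. A fan of `k` paths from a vertex `v` off `P` to `P`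
has total length at most `L / 2`, since otherwise a detour would lengthen `P`
(`two_mul_sum_length_fan_le`). If `k ≤ t`, fan paths of length at least 1 suffice. If `t < k`, Pósa
rotations of `Q` yield such a `v` with all neighbours on `Q`; a fan path of length 1 then ends in `P
∩ Q`, so the total is at least `2k - t`. If `P` covers all vertices, then `t = L + 1` and a
Dirac-type argument bounds `k`. -/

lemma exists_getVert_of_mem_support_take {p : G.Walk u v} {n : ℕ} {x : V}
    (hx : x ∈ (p.take n).support) : ∃ m, m ≤ n ∧ m ≤ p.length ∧ p.getVert m = x := by
  obtain ⟨m, hm, hle⟩ := mem_support_iff_exists_getVert.mp hx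
  rw [take_length] at hle
  rw [take_getVert, min_eq_right (by omega)] at hm
  exact ⟨m, by omega, by omega, hm⟩

lemma exists_getVert_of_mem_support_drop {p : G.Walk u v} {n : ℕ} (hn : n ≤ p.length) {x : V}
    (hx : x ∈ (p.drop n).support) : ∃ m, n ≤ m ∧ m ≤ p.length ∧ p.getVert m = x := by
  obtain ⟨m, hm, hle⟩ := mem_support_iff_exists_getVert.mp hx
  rw [drop_length] at hle
  rw [drop_getVert] at hm
  exact ⟨n + m, by omega, by omega, hm⟩

lemma IsPath.append {p : G.Walk u v} {q : G.Walk v w} (hp : p.IsPath) (hq : q.IsPath)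
    (h : ∀ x ∈ p.support, x ∈ q.support → x = v) : (p.append q).IsPath := by
  rw [isPath_def, support_append, List.nodup_append']
  have hq' := hq.support_nodup
  rw [← cons_tail_support] at hq'
  refine ⟨hp.support_nodup, (List.nodup_cons.mp hq').2, fun x hx hx' => ?_⟩
  obtain rfl := h x hx (List.mem_of_mem_tail hx')
  exact (List.nodup_cons.mp hq').1 hx'

/-- The initial part of a path up to the first vertex in `s`. -/
lemma IsPath.exists_isPath_first_mem {p : G.Walk u v} (hp : p.IsPath) {s : Set V} (hv : v ∈ s) :
    ∃ (f : V) (q : G.Walk u f), q.IsPath ∧ f ∈ s ∧ q.support ⊆ p.support ∧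
      ∀ x ∈ q.support, x ∈ s → x = f := by
  induction p with
  | nil => exact ⟨_, Walk.nil, by simp, hv, by simp, by simp⟩
  | @cons u w v h p ih =>
    by_cases hu : u ∈ s
    · exact ⟨u, Walk.nil, by simp, hu, by simp, by simp⟩
    rw [cons_isPath_iff] at hp
    obtain ⟨f, q, hq, hf, hsub, hs⟩ := ih hp.1 hv
    refine ⟨f, cons h q, ?_, hf, ?_, ?_⟩
    · rw [cons_isPath_iff]
      exact ⟨hq, fun hmem => hp.2 (hsub hmem)⟩
    · intro x hx
      rw [support_cons, List.mem_cons] at hx ⊢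
      exact hx.imp_right fun hx => hsub hx
    · intro x hx hxs
      rw [support_cons, List.mem_cons] at hx
      rcases hx with rfl | hx
      · exact absurd hxs hu
      · exact hs x hx hxs

/-- Pósa rotation of a path at its first vertex. -/
lemma IsPath.exists_rotation {p : G.Walk u v} (hp : p.IsPath) {i : ℕ} (hi : i < p.length)
    (h : G.Adj u (p.getVert (i + 1))) :
    ∃ q : G.Walk (p.getVert i) v, q.IsPath ∧ q.length = p.length ∧ q.support ⊆ p.support := by
  have hsub : ∀ x ∈ (cons h (p.drop (i + 1))).support,
      x = u ∨ ∃ m, i + 1 ≤ m ∧ m ≤ p.length ∧ p.getVert m = x := by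
    intro x hx
    rw [support_cons, List.mem_cons] at hx
    exact hx.imp_right fun hx => exists_getVert_of_mem_support_drop (by omega) hx
  -- Run backwards from vertex `i` to `u`, then jump along `h` to vertex `i + 1` and continue to
  -- `v`.
  refine ⟨(p.take i).reverse.append (cons h (p.drop (i + 1))), ?_, ?_, ?_⟩
  · refine (hp.take i).reverse.append ?_ ?_
    · refine (hp.drop _).cons fun hu => ?_
      obtain ⟨m, hm, hm', hmu⟩ := exists_getVert_of_mem_support_drop (by omega) hu
      rw [hp.getVert_eq_start_iff hm'] at hmu
      omega
    · intro x hx hx'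
      rw [support_reverse, List.mem_reverse] at hx
      obtain ⟨m, hm, hml, rfl⟩ := exists_getVert_of_mem_support_take hx
      rcases hsub _ hx' with hu | ⟨m', hm', hml', heq⟩
      · exact hu
      · have := hp.getVert_injOn hml' hml heq
        omega
  · simp only [length_append, length_reverse, take_length, length_cons, drop_length]
    omega
  · intro x hx
    rw [mem_support_append_iff, support_reverse, List.mem_reverse] at hx
    rcases hx with hx | hx
    · obtain ⟨m, -, -, rfl⟩ := exists_getVert_of_mem_support_take hx
      exact getVert_mem_support _ _
    · rcases hsub _ hx with rfl | ⟨m, -, -, rfl⟩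
      · exact start_mem_support _
      · exact getVert_mem_support _ _

/-- Replacing the part of a longest path between two of its vertices by a detour. -/
lemma IsLongestPath.length_detour_le {p : G.Walk u v} (hp : p.IsLongestPath) {i j : ℕ}
    (hij : i < j) (hj : j ≤ p.length) {q : G.Walk (p.getVert i) (p.getVert j)} (hq : q.IsPath)
    (h : ∀ x ∈ q.support, x ∈ p.support → x = p.getVert i ∨ x = p.getVert j) :
    i + q.length ≤ j := by
  have hinj := hp.1.getVert_injOn
  have hpath : ((p.take i).append (q.append (p.drop j))).IsPath := by
    refine (hp.1.take i).append (hq.append (hp.1.drop j) ?_) ?_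
    · intro x hx hx'
      obtain ⟨m, hm, hml, rfl⟩ := exists_getVert_of_mem_support_drop hj hx'
      rcases h _ hx (getVert_mem_support _ _) with h' | h'
      · have := hinj hml (show i ≤ p.length by omega) h'
        omega
      · exact h'
    · intro x hx hx'
      obtain ⟨m, hm, hml, rfl⟩ := exists_getVert_of_mem_support_take hx
      rw [mem_support_append_iff] at hx'
      rcases hx' with hx' | hx'
      · rcases h _ hx' (getVert_mem_support _ _) with h' | h'
        · exact h'
        · have := hinj hml hj h'
          omega
      · obtain ⟨m', hm', hml', heq⟩ := exists_getVert_of_mem_support_drop hj hx'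
        have := hinj hml' hml heq
        omega
  have := hp.2 _ _ _ hpath
  simp only [length_append, take_length, drop_length] at this
  omega

/-- Replacing the initial part of a longest path. -/
lemma IsLongestPath.length_le_of_prefix {p : G.Walk u v} (hp : p.IsLongestPath) {i : ℕ}
    (hi : i ≤ p.length) {q : G.Walk w (p.getVert i)} (hq : q.IsPath)
    (h : ∀ x ∈ q.support, x ∈ p.support → x = p.getVert i) : q.length ≤ i := by
  have hpath : (q.append (p.drop i)).IsPath := by
    refine hq.append (hp.1.drop i) fun x hx hx' => h x hx ?_
    obtain ⟨m, -, -, rfl⟩ := exists_getVert_of_mem_support_drop hi hx'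
    exact getVert_mem_support _ _
  have := hp.2 _ _ _ hpath
  simp only [length_append, drop_length] at this
  omega

/-- Replacing the final part of a longest path. -/
lemma IsLongestPath.add_length_le_of_suffix {p : G.Walk u v} (hp : p.IsLongestPath) {i : ℕ}
    (hi : i ≤ p.length) {q : G.Walk w (p.getVert i)} (hq : q.IsPath)
    (h : ∀ x ∈ q.support, x ∈ p.support → x = p.getVert i) : i + q.length ≤ p.length := by
  have hpath : ((p.take i).append q.reverse).IsPath := by
    refine (hp.1.take i).append hq.reverse fun x hx hx' => ?_
    rw [support_reverse, List.mem_reverse] at hx'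
    refine h x hx' ?_
    obtain ⟨m, -, -, rfl⟩ := exists_getVert_of_mem_support_take hx
    exact getVert_mem_support _ _
  have := hp.2 _ _ _ hpath
  simp only [length_append, length_reverse, take_length] at this
  omega

lemma IsLongestPath.mem_support_of_adj_start {p : G.Walk u v} (hp : p.IsLongestPath)
    (h : G.Adj w u) : w ∈ p.support := by
  by_contra hw
  have := hp.2 _ _ _ (hp.1.cons hw (h := h))
  rw [length_cons] at this
  omega

/-- A vertex preceding a neighbour of the first vertex of a longest path is the first vertex of
another longest path on the same vertices, so it has no neighbours off the path. -/
lemma IsLongestPath.mem_support_of_adj_getVert {p : G.Walk u v} (hp : p.IsLongestPath) {i : ℕ}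
    (hi : i < p.length) (h : G.Adj u (p.getVert (i + 1))) (hw : G.Adj w (p.getVert i)) :
    w ∈ p.support := by
  obtain ⟨q, hq, hlen, hsub⟩ := hp.1.exists_rotation hi h
  have hq' : q.IsLongestPath := ⟨hq, fun _ _ r hr => hlen ▸ hp.2 _ _ r hr⟩
  exact hsub (hq'.mem_support_of_adj_start hw)

end Walk

/-! ### Fans from a vertex to a longest path. -/

open Finset in
/-- Disjoint intervals `(x - w, x + w]` inside `(0, L]` have total length at most `L`. -/
lemma two_mul_sum_le_of_separated {ι : Type*} (S : Finset ι) (x w : ι → ℕ) (L : ℕ)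
    (hlow : ∀ i ∈ S, w i ≤ x i) (hup : ∀ i ∈ S, x i + w i ≤ L)
    (hsep : ∀ i ∈ S, ∀ j ∈ S, i ≠ j → x i + w i + w j ≤ x j ∨ x j + w j + w i ≤ x i) :
    2 * ∑ i ∈ S, w i ≤ L := by
  classical
  have hdisj : (S : Set ι).PairwiseDisjoint fun i => Ioc (x i - w i) (x i + w i) := by
    intro i hi j hj hij
    refine Finset.disjoint_left.mpr fun y hy hy' => ?_
    rw [mem_Ioc] at hy hy'
    rcases hsep i hi j hj hij with h | h <;> omega
  have hcard := card_biUnion hdisj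
  have hsub : S.biUnion (fun i => Ioc (x i - w i) (x i + w i)) ⊆ Ioc 0 L := by
    intro y hy
    obtain ⟨i, hi, hy⟩ := mem_biUnion.mp hy
    have := hup i hi
    rw [mem_Ioc] at hy ⊢
    omega
  have hle := card_le_card hsub
  rw [hcard, Nat.card_Ioc, sum_congr rfl (g := fun i => 2 * w i), ← mul_sum] at hle
  · exact hle
  · intro i hi
    have := hlow i hi
    rw [Nat.card_Ioc]
    omega

variable {V : Type*} {G : SimpleGraph V} {k : ℕ}

/-- In a `k`-connected graph there is a fan of `k` paths from `v` to any set `s` that contains a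
vertex `a` together with all its neighbours. -/
lemma IsKConnected.exists_fan (hk : G.IsKConnected k) {s : Set V} {v a : V} (hv : v ∉ s)
    (ha : a ∈ s) (hN : ∀ y, G.Adj y a → y ∈ s) :
    ∃ (S : Finset (G.Path v a)) (f : G.Path v a → V) (q : ∀ i, G.Walk v (f i)), S.card = k ∧
      (∀ i, (q i).IsPath ∧ f i ∈ s ∧ ∀ x ∈ (q i).support, x ∈ s → x = f i) ∧
      ∀ i ∈ S, ∀ j ∈ S, i ≠ j → ∀ x ∈ (q i).support, x ∈ (q j).support → x = v := by
  obtain ⟨S, hS, hdisj⟩ := hk v a (by rintro rfl; exact hv ha)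
  choose f q hq hf hsub hs using fun i : G.Path v a => i.2.exists_isPath_first_mem ha
  refine ⟨S, f, q, hS, fun i => ⟨hq i, hf i, hs i⟩, fun i hi j hj hij x hx hx' => ?_⟩
  rcases hdisj i hi j hj hij x (hsub i hx) (hsub j hx') with h | rfl
  · exact h
  -- No truncated path ends at `a`: its penultimate vertex, a neighbour of `a`, would already lie in
  -- `s`.
  have hend : ∀ (y : V) (r : G.Walk v y), y = x → (∀ z ∈ r.support, z ∈ s → z = y) → False := by
    rintro y r rfl hr
    have hnil : ¬ r.Nil := Walk.not_nil_of_ne (by rintro rfl; exact hv ha)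
    have hadj := r.adj_penultimate hnil
    exact hadj.ne (hr _ (r.getVert_mem_support _) (hN _ hadj))
  exact (hend _ (q i) (hs i x hx ha).symm (hs i)).elim

/-- A fan from a vertex off a longest path to the path takes at most half of its length. -/
lemma Walk.IsLongestPath.two_mul_sum_length_fan_le {a b v : V} {p : G.Walk a b}
    (hp : p.IsLongestPath) (hv : v ∉ p.support) {ι : Type*} (S : Finset ι) (f : ι → V)
    (q : ∀ i, G.Walk v (f i))
    (hq : ∀ i, (q i).IsPath ∧ f i ∈ p.support ∧ ∀ x ∈ (q i).support, x ∈ p.support → x = f i)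
    (hdisj : ∀ i ∈ S, ∀ j ∈ S, i ≠ j → ∀ x ∈ (q i).support, x ∈ (q j).support → x = v) :
    2 * ∑ i ∈ S, (q i).length ≤ p.length := by
  choose x hx hxl using fun i => mem_support_iff_exists_getVert.mp (hq i).2.1
  obtain rfl : f = fun i => p.getVert (x i) := funext fun i => (hx i).symm
  -- Two fan paths form a detour through `v` between their landing points, so the segment it
  -- replaces is at least as long.
  have key : ∀ i ∈ S, ∀ j ∈ S, i ≠ j → x i < x j →
      x i + (q i).length + (q j).length ≤ x j := by
    intro i hi j hj hij hlt
    have hpath : ((q i).reverse.append (q j)).IsPath := by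
      refine (hq i).1.reverse.append (hq j).1 fun y hy hy' => ?_
      rw [support_reverse, List.mem_reverse] at hy
      exact hdisj i hi j hj hij y hy hy'
    have := hp.length_detour_le hlt (hxl j) hpath fun y hy hyp => by
      rw [mem_support_append_iff, support_reverse, List.mem_reverse] at hy
      exact hy.imp (fun hy => (hq i).2.2 y hy hyp) (fun hy => (hq j).2.2 y hy hyp)
    simp only [length_append, length_reverse] at this
    omega
  refine two_mul_sum_le_of_separated S x _ _
    (fun i _ => hp.length_le_of_prefix (hxl i) (hq i).1 (hq i).2.2)
    (fun i _ => hp.add_length_le_of_suffix (hxl i) (hq i).1 (hq i).2.2) ?_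
  intro i hi j hj hij
  rcases lt_trichotomy (x i) (x j) with h | h | h
  · exact Or.inl (key i hi j hj hij h)
  · have hv' : p.getVert (x i) = v := by
      refine hdisj i hi j hj hij _ (end_mem_support _) ?_
      rw [h]
      exact end_mem_support _
    exact absurd (hv' ▸ getVert_mem_support p (x i)) hv
  · exact Or.inr (key j hj i hi hij.symm h)

/-! ### Degree bounds and rotations. -/

/-- Every vertex of a `k`-connected graph has `k` neighbours. -/
lemma IsKConnected.exists_finset_adj [DecidableEq V] [Nontrivial V] (hk : G.IsKConnected k)
    (a : V) : ∃ T : Finset V, T.card = k ∧ ∀ y ∈ T, G.Adj a y := by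
  obtain ⟨b, hb⟩ := exists_ne a
  obtain ⟨S, hS, hdisj⟩ := hk a b hb.symm
  refine ⟨S.image fun p => p.1.snd, ?_, ?_⟩
  · rw [← hS]
    refine Finset.card_image_of_injOn fun p hp q hq h => ?_
    by_contra hne
    have hadj := p.1.adj_snd (Walk.not_nil_of_ne hb.symm)
    have hsnd : ∀ r : G.Path a b, r.1.snd = b → r.1.length = 1 := by
      rintro ⟨r, hr⟩ h
      refine (hr.getVert_eq_end_iff ?_).mp h |>.symm
      have := Walk.not_nil_iff_lt_length.mp (Walk.not_nil_of_ne (p := r) hb.symm)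
      omega
    rcases hdisj p hp q hq hne p.1.snd (p.1.getVert_mem_support _)
      (by rw [show p.1.snd = q.1.snd from h]; exact q.1.getVert_mem_support _) with h' | h'
    · exact hadj.ne h'.symm
    -- If the shared second vertex is `b`, both paths are the single edge from `a` to `b`.
    · refine hne (Subtype.ext (Walk.ext_getVert_le_length ?_ ?_))
      · rw [hsnd p h', hsnd q (h ▸ h')]
      · intro m hm
        rw [hsnd p h'] at hm
        interval_cases m
        · simp
        · exact h
  · intro y hy
    obtain ⟨p, -, rfl⟩ := Finset.mem_image.mp hy
    exact p.1.adj_snd (Walk.not_nil_of_ne hb.symm)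

open Finset in
/-- The indices of the predecessors on a longest path of the neighbours of its first vertex. -/
lemma IsKConnected.le_card_filter_adj_getVert_succ [Nontrivial V] (hk : G.IsKConnected k)
    [DecidableRel G.Adj] {a b : V} {p : G.Walk a b} (hp : p.IsLongestPath) :
    k ≤ #{i ∈ range p.length | G.Adj a (p.getVert (i + 1))} := by
  classical
  obtain ⟨T, hT, hadj⟩ := hk.exists_finset_adj a
  rw [← hT]
  refine le_trans (card_le_card (t := image (fun i => p.getVert (i + 1))
    {i ∈ range p.length | G.Adj a (p.getVert (i + 1))}) fun y hy => ?_) card_image_le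
  obtain ⟨m, rfl, hm⟩ :=
    Walk.mem_support_iff_exists_getVert.mp (hp.mem_support_of_adj_start (hadj y hy).symm)
  have hm0 : m ≠ 0 := by
    rintro rfl
    simpa using hadj _ hy
  obtain ⟨i, rfl⟩ := Nat.exists_eq_succ_of_ne_zero hm0
  exact mem_image.mpr ⟨i, by simpa using ⟨by omega, hadj _ hy⟩, rfl⟩

open Finset in
/-- The indices of the neighbours on a longest path of its last vertex. -/
lemma IsKConnected.le_card_filter_adj_getVert [Nontrivial V] (hk : G.IsKConnected k)
    [DecidableRel G.Adj] {a b : V} {p : G.Walk a b} (hp : p.IsLongestPath) :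
    k ≤ #{i ∈ range p.length | G.Adj b (p.getVert i)} := by
  classical
  obtain ⟨T, hT, hadj⟩ := hk.exists_finset_adj b
  rw [← hT]
  refine le_trans (card_le_card (t := image p.getVert
    {i ∈ range p.length | G.Adj b (p.getVert i)}) fun y hy => ?_) card_image_le
  have hr : p.reverse.IsLongestPath :=
    ⟨hp.1.reverse, fun _ _ r hr => by simpa using hp.2 _ _ r hr⟩
  have hy' := hr.mem_support_of_adj_start (hadj y hy).symm
  rw [Walk.support_reverse, List.mem_reverse] at hy'
  obtain ⟨m, rfl, hm⟩ := Walk.mem_support_iff_exists_getVert.mp hy'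
  have hml : m ≠ p.length := by
    rintro rfl
    simpa using hadj _ hy
  exact mem_image.mpr ⟨m, by simpa using ⟨by omega, hadj _ hy⟩, rfl⟩

open Finset in
/-- Dirac's condition fails in a non-Hamiltonian `k`-connected graph with a Hamiltonian path. -/
lemma IsKConnected.two_mul_le_length [Fintype V] [DecidableEq V] [Nontrivial V]
    (hk : G.IsKConnected k) (hH : ¬ G.IsHamiltonian) {a b : V} {p : G.Walk a b}
    (hp : p.IsLongestPath) (hall : ∀ x, x ∈ p.support) (hlen : 2 ≤ p.length) :
    2 * k ≤ p.length := by
  classical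
  by_contra! hlt
  have h₁ := hk.le_card_filter_adj_getVert_succ hp
  have h₂ := hk.le_card_filter_adj_getVert hp
  -- Two sets of at least `k` indices among `p.length < 2 * k` must meet; rotating at a common index
  -- gives a path that an edge at `b` closes up.
  obtain ⟨i, hi⟩ : ∃ i, i ∈ ({i ∈ range p.length | G.Adj a (p.getVert (i + 1))} : Finset ℕ) ∩
      {i ∈ range p.length | G.Adj b (p.getVert i)} := by
    by_contra! hne
    have hd := disjoint_iff_inter_eq_empty.mpr (eq_empty_of_forall_notMem hne)
    have hc := card_le_card (union_subset (filter_subset (fun i => G.Adj a (p.getVert (i + 1)))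
      (range p.length)) (filter_subset (fun i => G.Adj b (p.getVert i)) (range p.length)))
    rw [card_union_of_disjoint hd, card_range] at hc
    omega
  simp only [mem_inter, mem_filter, mem_range] at hi
  obtain ⟨q, hq, hql, -⟩ := hp.1.exists_rotation hi.1.1 hi.1.2
  refine hH fun _ => ⟨b, Walk.cons hi.2.2 q, ?_⟩
  rw [Walk.isHamiltonianCycle_iff_isCycle_and_length_eq, Walk.cons_isCycle_iff]
  refine ⟨⟨hq, fun he => ?_⟩, ?_⟩
  -- A path containing the edge between its own ends has length 1, contrary to `hlen`.
  · rw [Sym2.eq_swap] at he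
    have := hq.length_eq_one_of_mem_edges he
    omega
  · rw [Walk.length_cons, hql, ← Walk.length_support,
      (hp.1.isHamiltonian_of_mem hall).length_support]

open Finset in
/-- If two longest paths share fewer than `k` vertices, then some vertex off the first one has all
its neighbours on the second one. -/
lemma IsKConnected.exists_notMem_support_forall_adj [DecidableEq V] [Nontrivial V]
    (hk : G.IsKConnected k) {a b c d : V} {p : G.Walk a b} {q : G.Walk c d}
    (hq : q.IsLongestPath) (hlt : #(p.support.toFinset ∩ q.support.toFinset) < k) :
    ∃ v, v ∉ p.support ∧ ∀ y, G.Adj y v → y ∈ q.support := by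
  classical
  by_contra! hcon
  have hle := hk.le_card_filter_adj_getVert_succ hq
  -- Each of these predecessors starts a rotation of `q`, so its neighbours all lie on `q`; by
  -- `hcon` it must then lie on `p`.
  have : #(image q.getVert {i ∈ range q.length | G.Adj c (q.getVert (i + 1))}) ≤
      #(p.support.toFinset ∩ q.support.toFinset) := by
    refine card_le_card fun y hy => ?_
    obtain ⟨i, hi, rfl⟩ := mem_image.mp hy
    rw [mem_filter, mem_range] at hi
    rw [mem_inter, List.mem_toFinset, List.mem_toFinset]
    refine ⟨?_, q.getVert_mem_support i⟩
    by_contra hnot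
    obtain ⟨y, hy, hyq⟩ := hcon _ hnot
    exact hyq (hq.mem_support_of_adj_getVert hi.1 hi.2 hy)
  rw [card_image_of_injOn] at this
  · omega
  · refine hq.1.getVert_injOn.mono fun i hi => ?_
    have hi' := mem_range.mp (mem_filter.mp (mem_coe.mp hi)).1
    exact hi'.le

end SimpleGraph

/-! ### The three cases of the inequality. -/

open SimpleGraph in
theorem mainTheorem3 {V : Type*} [Fintype V] [DecidableEq V] [Nontrivial V]
    (G : SimpleGraph V) (k L : ℕ) (hk : G.IsKConnected k) (hH : ¬ G.IsHamiltonian)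
    (hL : G.IsLongestPathLength L)
    {a b c d : V} (P : G.Walk a b) (Q : G.Walk c d)
    (hP : P.IsLongestPath) (hQ : Q.IsLongestPath) :
    ((P.support.toFinset ∩ Q.support.toFinset).card : ℝ) ≥ 2 * (k : ℝ) - (L : ℝ) / 2 := by
  suffices h : 4 * k ≤ 2 * (P.support.toFinset ∩ Q.support.toFinset).card + L by
    have h' : (4 : ℝ) * k ≤ 2 * ((P.support.toFinset ∩ Q.support.toFinset).card : ℝ) + L := by
      exact_mod_cast h
    linarith
  have length_eq : ∀ {x y : V} (R : G.Walk x y), R.IsLongestPath → R.length = L := by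
    intro x y R hR
    obtain ⟨u, v, R', hR', hlen⟩ := hL.1
    exact le_antisymm (hL.2 ⟨x, y, R, hR.1, rfl⟩) (hlen ▸ hR.2 u v R' hR')
  have hPL := length_eq P hP
  have hQL := length_eq Q hQ
  set t := (P.support.toFinset ∩ Q.support.toFinset).card with ht
  by_cases hall : ∀ x, x ∈ P.support
  · have hcard := (hP.1.isHamiltonian_of_mem hall).length_support
    rw [Walk.length_support] at hcard
    have hPu : P.support.toFinset = Finset.univ := by ext x; simp [hall x]
    have htL : t = L + 1 := by
      rw [ht, hPu, Finset.univ_inter, List.toFinset_card_of_nodup hQ.1.support_nodup,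
        Walk.length_support, hQL]
    rcases le_or_gt 2 L with h2 | h2
    · have := hk.two_mul_le_length hH hP hall (by omega)
      omega
    -- For `L ≤ 1` the bound `k ≤ L` is enough.
    · classical
      have := (hk.le_card_filter_adj_getVert hP).trans (Finset.card_filter_le _ _)
      rw [Finset.card_range] at this
      omega
  · rcases le_or_gt k t with hkt | hkt
    · push Not at hall
      obtain ⟨v, hv⟩ := hall
      obtain ⟨S, f, q, hS, hq, hdisj⟩ := hk.exists_fan (s := {x | x ∈ P.support}) hv
        P.start_mem_support fun y hy => hP.mem_support_of_adj_start hy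
      have hfan := hP.two_mul_sum_length_fan_le hv S f q hq hdisj
      have hone : ∀ i ∈ S, 1 ≤ (q i).length := fun i _ =>
        Walk.not_nil_iff_lt_length.mp
          (Walk.not_nil_of_ne fun h => hv (h ▸ (hq i).2.1))
      have := Finset.card_nsmul_le_sum S _ 1 hone
      rw [hS, smul_eq_mul] at this
      omega
    · obtain ⟨v, hv, hvQ⟩ := hk.exists_notMem_support_forall_adj (p := P) hQ hkt
      obtain ⟨S, f, q, hS, hq, hdisj⟩ := hk.exists_fan (s := {x | x ∈ P.support}) hv
        P.start_mem_support fun y hy => hP.mem_support_of_adj_start hy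
      have hfan := hP.two_mul_sum_length_fan_le hv S f q hq hdisj
      have hlen : ∀ i ∈ S, 2 ≤ (q i).length + if f i ∈ Q.support then 1 else 0 := by
        intro i _
        have hpos : 0 < (q i).length := Walk.not_nil_iff_lt_length.mp
          (Walk.not_nil_of_ne fun h => hv (h ▸ (hq i).2.1))
        split_ifs with hi
        · omega
        · by_contra hlt
          exact hi (hvQ _ (Walk.adj_of_length_eq_one (p := q i) (by omega)).symm)
      -- Landing vertices are distinct, because fan paths meet only at `v`, which is off `P`.
      have hcard : (S.filter fun i => f i ∈ Q.support).card ≤ t := by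
        refine Finset.card_le_card_of_injOn f (fun i hi => ?_) fun i hi j hj hij => ?_
        · have hi' := (Finset.mem_filter.mp hi).2
          simpa using ⟨(hq i).2.1, hi'⟩
        · by_contra hne
          have := hdisj i (Finset.mem_filter.mp hi).1 j (Finset.mem_filter.mp hj).1 hne (f i)
            (Walk.end_mem_support _) (by rw [show f i = f j from hij]; exact Walk.end_mem_support _)
          exact hv (this ▸ (hq i).2.1)
      -- Summing gives `2k ≤ total + t`, while `hfan` gives `2 * total ≤ L`.
      have hsum := Finset.card_nsmul_le_sum S _ 2 hlen
      rw [Finset.sum_add_distrib, ← Finset.card_filter, hS, smul_eq_mul] at hsum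
      omega
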